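/- For an ordinal $\varepsilon$, an inverse system of abelian groups over $\varepsilon$ is a contravariant functor $\mathbf{X}$ from the ordered set $\varepsilon=\{\alpha\mid\alpha<\varepsilon\}$ to abelian groups: groups $X_\alpha$ $(\alpha<\varepsilon)$ with bonding homomorphisms $x_{\alpha\beta}:X_\beta\to X_\alpha$ for $\alpha\le\beta<\varepsilon$. It is called free if there is a set $\mathcal{B}$ of elements of the (disjoint) groups $X_\beta$, $\beta<\varepsilon$, such that for all $\alpha<\varepsilon$, every $x\in X_\alpha$ has a unique expression as a finite sum $x=\sum_{i<k}a_i\,x_{\alpha\beta_i}(b_i)$ with $a_i$ nonzero integers and $b_i\in\mathcal{B}\cap X_{\beta_i}$ distinct, $\beta_i\ge\alpha$. For a set $A$ of ordinals and $n\ge 0$, let $P_n(A)=\bigoplus_{[A]^{n+1}}\mathbb{Z}$ be the free abelian group on the strictly increasing $(n+1)$-tuples $\vec\alpha=(\alpha_0,\dots,\alpha_n)$ of elements of $A$, with generators $\langle\vec\alpha\rangle$. For $n\ge 1$ let $d_n:P_n(A)\to P_{n-1}(A)$ be the homomorphism $\langle\vec\alpha\rangle\mapsto\sum_{i=0}^n(-1)^i\langle\vec\alpha^{\,i}\rangle$,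 where $\vec\alpha^{\,i}$ is $\vec\alpha$ with its coordinate $\alpha_i$ removed. Let $\mathbf{P}_n(\varepsilon)$ be the inverse system over $\varepsilon$ with terms $P_n([\alpha,\varepsilon))$ $(\alpha<\varepsilon)$ and the natural inclusions as bonding maps. The maps $d_n$ form a morphism $\mathbf{d}_n:\mathbf{P}_n(\varepsilon)\to\mathbf{P}_{n-1}(\varepsilon)$; let $\mathbf{d}_n\mathbf{P}_n(\varepsilon)$ be its image, the subsystem of $\mathbf{P}_{n-1}(\varepsilon)$ with terms $d_n(P_n([\alpha,\varepsilon)))$. Theorem. For every integer $n\ge 1$, $\omega_n$ is the least ordinal $\varepsilon$ such that the inverse system $\mathbf{d}_n\mathbf{P}_n(\varepsilon)$ is not free. That is, $\mathbf{d}_n\mathbf{P}_n(\omega_n)$ is not free, while $\mathbf{d}_n\mathbf{P}_n(\varepsilon)$ is free for every ordinal $\varepsilon<\omega_n$. -/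

import Mathlib

open CategoryTheory Opposite
open scoped Ordinal

universe u v w

namespace OrdinalSystems

/-- `[A]^k`: the strictly increasing `k`-tuples of elements of a set `A` of ordinals. -/
abbrev Tuples (A : Set Ordinal.{u}) (k : ℕ) : Type (u + 1) := Fin k ↪o A

/-- The tuple `σ` with its `i`-th coordinate removed. -/
def Tuples.face {A : Set Ordinal.{u}} {k : ℕ} (σ : Tuples A (k + 1)) (i : Fin (k + 1)) :
    Tuples A k :=
  (Fin.succAboveOrderEmb i).trans σ

/-- A tuple of elements of `A`, seen as a tuple of elements of a larger set `A'`. -/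
def Tuples.incl {A A' : Set Ordinal.{u}} (h : A ⊆ A') {k : ℕ} (σ : Tuples A k) : Tuples A' k :=
  σ.trans (Subtype.orderEmbedding h)

/-- The free abelian group `⨁_{[A]^k} ℤ`. Thus `P_n(A)` is `Chains A (n + 1)`, and `Chains A 0`
is `ℤ` (there is exactly one empty tuple). -/
abbrev Chains (A : Set Ordinal.{u}) (k : ℕ) : Type (u + 1) := Tuples A k →₀ ℤ

/-- The boundary map `d_n : P_n(A) → P_{n-1}(A)`, `⟨σ⟩ ↦ ∑_{i ≤ n} (-1)^i ⟨σ^i⟩`; for `n = 0` it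
is the augmentation `P_0(A) → ℤ`, `⟨β⟩ ↦ 1`. -/
noncomputable def boundary (A : Set Ordinal.{u}) (n : ℕ) : Chains A (n + 1) →+ Chains A n :=
  (Finsupp.linearCombination ℤ fun σ : Tuples A (n + 1) =>
    ∑ i : Fin (n + 1), Finsupp.single (σ.face i) ((-1 : ℤ) ^ (i : ℕ))).toAddMonoidHom

/-- The natural inclusion `⨁_{[A]^k} ℤ → ⨁_{[A']^k} ℤ` for `A ⊆ A'`, `⟨σ⟩ ↦ ⟨σ⟩`. -/
noncomputable def chainsIncl {A A' : Set Ordinal.{u}} (h : A ⊆ A') (k : ℕ) :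
    Chains A k →+ Chains A' k :=
  Finsupp.mapDomain.addMonoidHom (Tuples.incl h)

theorem boundary_single (A : Set Ordinal.{u}) (n : ℕ) (σ : Tuples A (n + 1)) (z : ℤ) :
    boundary A n (Finsupp.single σ z) =
      z • ∑ i : Fin (n + 1), Finsupp.single (σ.face i) ((-1 : ℤ) ^ (i : ℕ)) := by
  simp [boundary]

theorem chainsIncl_single {A A' : Set Ordinal.{u}} (h : A ⊆ A') (k : ℕ) (σ : Tuples A k) (z : ℤ) :
    chainsIncl h k (Finsupp.single σ z) = Finsupp.single (σ.incl h) z := by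
  simp [chainsIncl]

theorem chainsIncl_self {A : Set Ordinal.{u}} (h : A ⊆ A) (k : ℕ) :
    chainsIncl h k = AddMonoidHom.id (Chains A k) := by
  refine Finsupp.addHom_ext fun σ z => ?_
  rw [chainsIncl_single]
  rfl

theorem chainsIncl_comp {A A' A'' : Set Ordinal.{u}} (h : A ⊆ A') (h' : A' ⊆ A'')
    (h'' : A ⊆ A'') (k : ℕ) :
    (chainsIncl h' k).comp (chainsIncl h k) = chainsIncl h'' k := by
  refine Finsupp.addHom_ext fun σ z => ?_
  simp only [AddMonoidHom.comp_apply, chainsIncl_single]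
  rfl

theorem boundary_comp_chainsIncl {A A' : Set Ordinal.{u}} (h : A ⊆ A') (n : ℕ) :
    (boundary A' n).comp (chainsIncl h (n + 1)) = (chainsIncl h n).comp (boundary A n) := by
  refine Finsupp.addHom_ext fun σ z => ?_
  simp only [AddMonoidHom.comp_apply, chainsIncl_single, boundary_single, map_zsmul, map_sum]
  rfl

/-- Inverse systems of abelian groups over a partial order `I`, i.e. contravariant functors from
`I` to abelian groups. The bonding map `x_{ij} : X_j → X_i`, `i ≤ j`, is `bond X h`. -/
abbrev InvSys (I : Type v) [PartialOrder I] := Iᵒᵖ ⥤ AddCommGrpCat.{w}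

/-- The term `X_i`. -/
abbrev InvSys.term {I : Type v} [PartialOrder I] (X : InvSys.{v, w} I) (i : I) : Type w :=
  X.obj (op i)

/-- The bonding map `x_{ij} : X_j → X_i`. -/
abbrev InvSys.bond {I : Type v} [PartialOrder I] (X : InvSys.{v, w} I) {i j : I} (h : i ≤ j) :
    X.term j →+ X.term i :=
  (X.map (homOfLE h).op).hom

/-- An inverse system `X` is free if there is a set `B` of elements of the terms of `X` (an element
of `B` is a pair of an index `j` and an element of `X_j`) such that every element `x` of every `X_i`
is in exactly one way a finite integer combination `∑ a_b • x_{ij}(b)` of images of elements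
`b = (j, b)` of `B` with `i ≤ j`. -/
def InvSys.IsFree {I : Type v} [PartialOrder I] (X : InvSys.{v, w} I) : Prop :=
  ∃ B : Set (Σ j : I, X.term j), ∀ (i : I) (x : X.term i),
    ∃! a : {b : Σ j : I, X.term j // b ∈ B ∧ i ≤ b.1} →₀ ℤ,
      x = a.sum fun b z => z • X.bond b.2.2 b.1.2

/-- The image of a morphism `f : X ⟶ Y` of inverse systems, computed pointwise: its terms are the
subgroups `f_i(X_i)` of the groups `Y_i`, and its bonding maps are the restrictions of those
of `Y`. -/
def InvSys.image {I : Type v} [PartialOrder I] {X Y : InvSys.{v, w} I} (f : X ⟶ Y) :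
    InvSys.{v, w} I where
  obj i := AddCommGrpCat.of (f.app i).hom.range
  map {i j} g := AddCommGrpCat.ofHom <|
    ((Y.map g).hom.comp (f.app i).hom.range.subtype).codRestrict (f.app j).hom.range <| by
      rintro ⟨_, x, rfl⟩
      exact ⟨(X.map g).hom x, ConcreteCategory.congr_hom (f.naturality g) x⟩
  map_id i := by ext x; simp
  map_comp g g' := by ext x; simp

/-- The inverse system over `ε` with terms `⨁_{[[α, ε)]^k} ℤ` and the natural inclusions as bonding
maps. -/
noncomputable def chainSys (k : ℕ) (ε : Ordinal.{u}) : InvSys.{u + 1, u + 1} (Set.Iio ε) where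
  obj α := AddCommGrpCat.of (Chains (Set.Ico (α.unop : Ordinal.{u}) ε) k)
  map g := AddCommGrpCat.ofHom (chainsIncl (Set.Ico_subset_Ico_left (leOfHom g.unop)) k)
  map_id α := by rw [chainsIncl_self]; rfl
  map_comp g g' := by
    rw [← AddCommGrpCat.ofHom_comp, chainsIncl_comp]

/-- The inverse system `P_n(ε)`. -/
noncomputable abbrev P (n : ℕ) (ε : Ordinal.{u}) : InvSys.{u + 1, u + 1} (Set.Iio ε) :=
  chainSys (n + 1) ε

/-- The boundary morphism `d_n` of inverse systems on `P_n(ε)`. Its codomain `chainSys n ε` is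
`P_{n-1}(ε)` for `n ≥ 1`, and the constant system `Δ_ε(ℤ)` for `n = 0`. -/
noncomputable def d (n : ℕ) (ε : Ordinal.{u}) : P n ε ⟶ chainSys n ε where
  app α := AddCommGrpCat.ofHom (boundary (Set.Ico (α.unop : Ordinal.{u}) ε) n)
  naturality _ _ g := congrArg AddCommGrpCat.ofHom
    (boundary_comp_chainsIncl (Set.Ico_subset_Ico_left (leOfHom g.unop)) n)

/-- The inverse system `d_n P_n(ε)`. -/
noncomputable def dP (n : ℕ) (ε : Ordinal.{u}) : InvSys.{u + 1, u + 1} (Set.Iio ε) :=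
  InvSys.image (d n ε)

end OrdinalSystems

/-! Identify increasing tuples with finite sets of ordinals, so that bonding maps become inclusions
and `dP n ε` becomes the group of boundaries of `n`-simplices on `ε`, filtered by the intervals `[α,
ε)`. Both halves are inductions on `n` driven by ∂(a∗x) = x − a∗∂x (`bdry_cone`), where a∗x is the
join of x with the vertex a.

Freeness below ω_n (`exists_isFilteredBasis`). A set of size at most ℵ_n can be enumerated in type
ω_n with every initial segment of size less than ℵ_n. Joining each vertex v to the chains of a basis
for the vertices enumerated before v gives a basis one dimension up (`isFilteredBasis_cone`). The
enumeration is unrelated to the order of the ordinals, which governs only the filtration.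

Non-freeness at ω_n (`not_isSplitting`). Freeness makes the boundary map split compatibly with the
filtration. Given a splitting φ in dimension n + 1, choose an ω_n-sequence whose downward closure D'
contains the vertices of φ on chains of the sequence, and a point δ above it. Then x ↦ cut_{D'}
φ(δ∗x) is a splitting in dimension n (`IsSplitting.descend`). In dimension 0 the value of φ on a
vertex would have all its vertices arbitrarily high. -/

namespace OrdinalSystems

/-! ### Chains of finite sets: boundary, cone, and cutting along a vertex set. -/

section SimplexChains

variable {L : Type v}

open Classical in
/-- The projection onto the span of the finite subsets of `A`. -/
noncomputable def proj (A : Set L) : (Finset L →₀ ℤ) →ₗ[ℤ] (Finset L →₀ ℤ) :=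
  Finsupp.linearCombination ℤ fun s => if (s : Set L) ⊆ A then Finsupp.single s 1 else 0

theorem proj_single_of_subset {A : Set L} {s : Finset L} (h : (s : Set L) ⊆ A) (z : ℤ) :
    proj A (Finsupp.single s z) = Finsupp.single s z := by
  simp [proj, h]

theorem proj_single_of_not_subset {A : Set L} {s : Finset L} (h : ¬ (s : Set L) ⊆ A) (z : ℤ) :
    proj A (Finsupp.single s z) = 0 := by
  simp [proj, h]

/-- The chains on the `k`-element subsets of `A`. -/
def simplexChains (A : Set L) (k : ℕ) : Submodule ℤ (Finset L →₀ ℤ) :=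
  Finsupp.supported ℤ ℤ {s | (s : Set L) ⊆ A ∧ s.card = k}

theorem single_mem_simplexChains {A : Set L} {k : ℕ} {s : Finset L} (hs : (s : Set L) ⊆ A)
    (hk : s.card = k) (z : ℤ) : Finsupp.single s z ∈ simplexChains A k :=
  Finsupp.single_mem_supported ℤ z ⟨hs, hk⟩

theorem simplexChains_le {A : Set L} {k : ℕ} {N : Submodule ℤ (Finset L →₀ ℤ)}
    (h : ∀ s : Finset L, (s : Set L) ⊆ A → s.card = k → Finsupp.single s 1 ∈ N) :
    simplexChains A k ≤ N := by
  rw [simplexChains, Finsupp.supported_eq_span_single, Submodule.span_le]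
  rintro _ ⟨s, ⟨hs, hk⟩, rfl⟩
  exact h s hs hk

theorem simplexChains_mono {A A' : Set L} (h : A ⊆ A') (k : ℕ) :
    simplexChains A k ≤ simplexChains A' k :=
  simplexChains_le fun _ hs hk => single_mem_simplexChains (hs.trans h) hk 1

theorem map_eq_map_of_mem_simplexChains {A : Set L} {k : ℕ} {N : Type*} [AddCommGroup N]
    {f g : (Finset L →₀ ℤ) →ₗ[ℤ] N}
    (h : ∀ s : Finset L, (s : Set L) ⊆ A → s.card = k →
      f (Finsupp.single s 1) = g (Finsupp.single s 1))
    {x : Finset L →₀ ℤ} (hx : x ∈ simplexChains A k) : f x = g x :=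
  simplexChains_le (N := LinearMap.eqLocus f g) h hx

theorem map_mem_of_mem_simplexChains {A : Set L} {k : ℕ} {N : Type*} [AddCommGroup N]
    {f : (Finset L →₀ ℤ) →ₗ[ℤ] N} {K : Submodule ℤ N}
    (h : ∀ s : Finset L, (s : Set L) ⊆ A → s.card = k → f (Finsupp.single s 1) ∈ K)
    {x : Finset L →₀ ℤ} (hx : x ∈ simplexChains A k) : f x ∈ K :=
  simplexChains_le (N := K.comap f) h hx

theorem proj_mem {A B : Set L} {k : ℕ} {x : Finset L →₀ ℤ} (hx : x ∈ simplexChains B k) :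
    proj A x ∈ simplexChains (A ∩ B) k := by
  refine map_mem_of_mem_simplexChains (fun s hs hk => ?_) hx
  by_cases h : (s : Set L) ⊆ A
  · rw [proj_single_of_subset h]
    exact single_mem_simplexChains (Set.subset_inter h hs) hk 1
  · rw [proj_single_of_not_subset h]; exact zero_mem _

theorem proj_eq_self {A : Set L} {k : ℕ} {x : Finset L →₀ ℤ} (hx : x ∈ simplexChains A k) :
    proj A x = x :=
  map_eq_map_of_mem_simplexChains (g := LinearMap.id)
    (fun _ hs _ => proj_single_of_subset hs 1) hx

variable [LinearOrder L]

/-- The sign `(-1)^p`, where `p` is the number of elements of `s` below `a`. -/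
def vertexSign (a : L) (s : Finset L) : ℤ := (-1) ^ (s.filter (· < a)).card

theorem vertexSign_mul_self (a : L) (s : Finset L) : vertexSign a s * vertexSign a s = 1 := by
  rw [vertexSign, ← mul_pow]; simp

theorem vertexSign_insert {a i : L} {s : Finset L} (hi : i ∉ s) :
    vertexSign a (insert i s) = (if i < a then -1 else 1) * vertexSign a s := by
  unfold vertexSign
  rw [Finset.filter_insert]
  split_ifs with h
  · rw [Finset.card_insert_of_notMem (by simp [hi]), pow_succ']
  · simp

theorem vertexSign_insert_self (a : L) (s : Finset L) :
    vertexSign a (insert a s) = vertexSign a s := by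
  unfold vertexSign
  rw [Finset.filter_insert, if_neg (lt_irrefl a)]

variable (L) in
/-- The boundary operator on the free abelian group on all finite subsets of `L`. -/
noncomputable def bdry : (Finset L →₀ ℤ) →ₗ[ℤ] (Finset L →₀ ℤ) :=
  Finsupp.linearCombination ℤ fun s => ∑ i ∈ s, Finsupp.single (s.erase i) (vertexSign i s)

/-- The join with the vertex `a`. -/
noncomputable def cone (a : L) : (Finset L →₀ ℤ) →ₗ[ℤ] (Finset L →₀ ℤ) :=
  Finsupp.linearCombination ℤ fun s =>
    if a ∈ s then 0 else Finsupp.single (insert a s) (vertexSign a s)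

theorem bdry_single (s : Finset L) (z : ℤ) : bdry L (Finsupp.single s z) =
    z • ∑ i ∈ s, Finsupp.single (s.erase i) (vertexSign i s) := by
  simp [bdry]

theorem cone_single_of_mem {a : L} {s : Finset L} (h : a ∈ s) (z : ℤ) :
    cone a (Finsupp.single s z) = 0 := by
  simp [cone, h]

theorem cone_single_of_notMem {a : L} {s : Finset L} (h : a ∉ s) (z : ℤ) :
    cone a (Finsupp.single s z) = Finsupp.single (insert a s) (z * vertexSign a s) := by
  simp [cone, h]

/-- The sign in `cone` makes `a` behave as a first vertex wherever it falls in the order, so `cone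
a` is a contracting homotopy. -/
theorem bdry_cone (a : L) (x : Finset L →₀ ℤ) :
    bdry L (cone a x) = x - cone a (bdry L x) := by
  rw [eq_sub_iff_add_eq]
  induction x using Finsupp.induction_linear with
  | zero => simp
  | add x y hx hy =>
    simp only [map_add]
    rw [add_add_add_comm, hx, hy]
  | single s z =>
    by_cases ha : a ∈ s
    · rw [cone_single_of_mem ha, map_zero, zero_add, bdry_single, map_smul, map_sum,
        Finset.sum_eq_single_of_mem a ha]
      · rw [cone_single_of_notMem (Finset.notMem_erase a s), Finset.insert_erase ha]
        have h : vertexSign a s = vertexSign a (s.erase a) := by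
          rw [← vertexSign_insert_self a (s.erase a), Finset.insert_erase ha]
        rw [h, vertexSign_mul_self]
        simp
      · intro i _ hia
        exact cone_single_of_mem (Finset.mem_erase.2 ⟨hia.symm, ha⟩) _
    · rw [cone_single_of_notMem ha, bdry_single, bdry_single, Finset.sum_insert ha,
        Finset.erase_insert ha, vertexSign_insert_self, map_smul, map_sum, smul_add, add_assoc,
        Finset.smul_sum, Finset.smul_sum, ← Finset.sum_add_distrib, Finset.sum_eq_zero, add_zero]
      · simp [mul_assoc, vertexSign_mul_self]
      · intro i hi
        have hia : i ≠ a := fun h => ha (h ▸ hi)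
        have ha' : a ∉ s.erase i := fun h => ha (Finset.mem_of_mem_erase h)
        rw [cone_single_of_notMem ha', Finset.erase_insert_of_ne hia.symm, vertexSign_insert ha]
        have h1 : vertexSign a s = (if i < a then -1 else 1) * vertexSign a (s.erase i) := by
          rw [← vertexSign_insert (Finset.notMem_erase i s), Finset.insert_erase hi]
        rw [h1, Finsupp.smul_single, Finsupp.smul_single, ← Finsupp.single_add]
        rw [Finsupp.single_eq_zero]
        -- Exactly one of `i < a` and `a < i` holds, so exactly one of the two signs flips and the
        -- terms cancel.
        rcases lt_or_gt_of_ne hia with h | h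
        · simp only [h, if_true, h.not_gt, if_false, smul_eq_mul]; ring
        · simp only [h, if_true, h.not_gt, if_false, smul_eq_mul]; ring

/-- A nonempty simplex is, up to sign, the cone over a smaller one, so the cone formula reduces the
claim to that smaller simplex. -/
theorem bdry_bdry (x : Finset L →₀ ℤ) : bdry L (bdry L x) = 0 := by
  induction x using Finsupp.induction_linear with
  | zero => simp
  | add x y hx hy => simp [hx, hy]
  | single s z =>
    induction s using Finset.induction_on generalizing z with
    | empty => simp [bdry_single]
    | insert a s ha ih =>
      have h : Finsupp.single (insert a s) z
          = cone a (Finsupp.single s (z * vertexSign a s)) := by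
        rw [cone_single_of_notMem ha, mul_assoc, vertexSign_mul_self, mul_one]
      rw [h, bdry_cone, map_sub, bdry_cone, ih]
      simp

theorem proj_cone {A : Set L} {a : L} (ha : a ∉ A) (x : Finset L →₀ ℤ) :
    proj A (cone a x) = 0 := by
  induction x using Finsupp.induction_linear with
  | zero => simp
  | add x y hx hy => simp [hx, hy]
  | single s z =>
    by_cases h : a ∈ s
    · simp [cone_single_of_mem h]
    · rw [cone_single_of_notMem h, proj_single_of_not_subset]
      exact fun h' => ha (h' (by simp))

theorem bdry_mem {A : Set L} {k : ℕ} {x : Finset L →₀ ℤ} (hx : x ∈ simplexChains A k) :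
    bdry L x ∈ simplexChains A (k - 1) := by
  refine map_mem_of_mem_simplexChains (fun s hs hk => ?_) hx
  rw [bdry_single, one_smul]
  refine Submodule.sum_mem _ fun i hi => single_mem_simplexChains ?_ ?_ _
  · exact fun j hj => hs (Finset.mem_of_mem_erase hj)
  · rw [Finset.card_erase_of_mem hi, hk]

theorem cone_mem {A : Set L} {k : ℕ} {a : L} (ha : a ∈ A) {x : Finset L →₀ ℤ}
    (hx : x ∈ simplexChains A k) : cone a x ∈ simplexChains A (k + 1) := by
  refine map_mem_of_mem_simplexChains (fun s hs hk => ?_) hx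
  by_cases h : a ∈ s
  · rw [cone_single_of_mem h]; exact zero_mem _
  · rw [cone_single_of_notMem h]
    refine single_mem_simplexChains ?_ ?_ _
    · rw [Finset.coe_insert]; exact Set.insert_subset ha hs
    · rw [Finset.card_insert_of_notMem h, hk]

/-- The commutator of the boundary operator and the projection onto the chains on `A`. It removes
from a simplex with exactly one vertex outside `A` this vertex. -/
noncomputable def cut (A : Set L) : (Finset L →₀ ℤ) →ₗ[ℤ] (Finset L →₀ ℤ) :=
  proj A ∘ₗ bdry L - bdry L ∘ₗ proj A

theorem cut_apply (A : Set L) (x : Finset L →₀ ℤ) :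
    cut A x = proj A (bdry L x) - bdry L (proj A x) := rfl

theorem cut_bdry (A : Set L) (x : Finset L →₀ ℤ) : cut A (bdry L x) = - bdry L (cut A x) := by
  simp [cut_apply, bdry_bdry]

theorem cut_mem {A B : Set L} {k : ℕ} {x : Finset L →₀ ℤ} (hx : x ∈ simplexChains B k) :
    cut A x ∈ simplexChains (A ∩ B) (k - 1) :=
  sub_mem (proj_mem (bdry_mem hx)) (bdry_mem (proj_mem hx))

theorem cut_eq_zero {A : Set L} {k : ℕ} {x : Finset L →₀ ℤ} (hx : x ∈ simplexChains A k) :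
    cut A x = 0 := by
  rw [cut_apply, proj_eq_self hx, proj_eq_self (bdry_mem hx), sub_self]

/-- Cutting undoes a join with an outside vertex. With `cut_eq_zero` and `cut_bdry`, this isolates
the contribution of one vertex in both halves of the argument. -/
theorem cut_cone {A : Set L} {k : ℕ} {a : L} (ha : a ∉ A) {x : Finset L →₀ ℤ}
    (hx : x ∈ simplexChains A k) : cut A (cone a x) = x := by
  rw [cut_apply, proj_cone ha, bdry_cone, map_sub, proj_cone ha, proj_eq_self hx]
  simp

end SimplexChains

/-! ### Filtered bases of boundaries on small vertex sets. -/

section Bases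

variable {L : Type v} [LinearOrder L]

/-- A family of chains whose boundaries are a basis, compatible with the filtration by the sets
`A ∩ [α, ∞)`, of the boundaries of the `(n + 1)`-element simplices on `A`. -/
structure IsFilteredBasis (A : Set L) (n : ℕ) {J : Type w} (lvl : J → L)
    (x : J → Finset L →₀ ℤ) : Prop where
  lvl_mem : ∀ j, lvl j ∈ A
  mem : ∀ j, x j ∈ simplexChains (A ∩ Set.Ici (lvl j)) (n + 1)
  indep : LinearIndependent ℤ fun j => bdry L (x j)
  span : ∀ α, ∀ z ∈ simplexChains (A ∩ Set.Ici α) (n + 1),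
    bdry L z ∈ Submodule.span ℤ ((fun j => bdry L (x j)) '' {j | α ≤ lvl j})

/-- All vertices have the same boundary ⟨∅⟩; the largest vertex represents it at the highest
possible level. Finiteness provides that vertex. -/
theorem exists_isFilteredBasis_zero {A : Set L} (hA : A.Finite) :
    ∃ (J : Type v) (lvl : J → L) (x : J → Finset L →₀ ℤ), IsFilteredBasis A 0 lvl x := by
  rcases A.eq_empty_or_nonempty with rfl | hne
  · refine ⟨PEmpty, PEmpty.elim, PEmpty.elim, fun j => j.elim, fun j => j.elim,
      linearIndependent_empty_type, fun α z hz => ?_⟩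
    refine map_mem_of_mem_simplexChains (fun s hs hk => ?_) hz
    obtain ⟨i, rfl⟩ := Finset.card_eq_one.1 hk
    simp at hs
  · obtain ⟨m, hm, hmax⟩ := hA.exists_maximalFor id A hne
    have hb : ∀ i : L, bdry L (Finsupp.single {i} 1) = Finsupp.single ∅ 1 := by
      intro i
      simp [bdry_single, vertexSign, Finset.filter_singleton]
    refine ⟨PUnit, fun _ => m, fun _ => Finsupp.single {m} 1, fun _ => hm, fun _ => ?_, ?_, ?_⟩
    · exact single_mem_simplexChains (by simpa using hm) (by simp) 1
    · refine LinearIndependent.of_subsingleton PUnit.unit ?_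
      rw [hb]
      simp
    · intro α z hz
      refine map_mem_of_mem_simplexChains (fun s hs hk => ?_) hz
      obtain ⟨i, rfl⟩ := Finset.card_eq_one.1 hk
      have hi : i ∈ A ∧ α ≤ i := by simpa using hs
      have him : i ≤ m := (le_total i m).elim id fun h => hmax hi.1 h
      refine Submodule.subset_span ⟨PUnit.unit, hi.2.trans him, ?_⟩
      simp only [hb]

variable {W : Type v} [LinearOrder W] {A : Set L} {e : L → W}

/-- The elements of `A` which are enumerated before `v`. -/
def before (A : Set L) (e : L → W) (v : L) : Set L := {y | y ∈ A ∧ e y < e v}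

/-- One reduction step: a cycle whose last vertex is `v` is modified by boundaries of cones
over `v` until `v` is no longer one of its vertices. -/
theorem exists_reduction {n : ℕ} (he : Set.InjOn e A) {J : L → Type v}
    {lvl : ∀ v, J v → L} {x : ∀ v, J v → Finset L →₀ ℤ}
    (H : ∀ v ∈ A, IsFilteredBasis (before A e v) n (lvl v) (x v)) {α : L}
    {z : Finset L →₀ ℤ} (hz : z ∈ simplexChains (A ∩ Set.Ici α) (n + 1)) (hdz : bdry L z = 0)
    (hz0 : z ≠ 0) :
    ∃ v ∈ A, (∃ s ∈ z.support, v ∈ s) ∧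
      ∃ u : Finset L →₀ ℤ, u ∈ simplexChains (before A e v ∩ Set.Ici α) (n + 1) ∧ bdry L u = 0 ∧
      z - u ∈ Submodule.span ℤ ((fun j : Σ v : A, J v => bdry L (cone j.1.1 (x j.1 j.2))) ''
        {j | α ≤ min (lvl j.1 j.2) j.1}) := by
  classical
  have hsub : ∀ s ∈ z.support, (s : Set L) ⊆ A ∩ Set.Ici α ∧ s.card = n + 1 := fun s hs => hz hs
  have hne : (z.support.biUnion id).Nonempty := by
    obtain ⟨s, hs⟩ := Finsupp.support_nonempty_iff.2 hz0
    obtain ⟨i, hi⟩ := Finset.card_pos.1 (by rw [(hsub s hs).2]; omega : 0 < s.card)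
    exact ⟨i, Finset.mem_biUnion.2 ⟨s, hs, hi⟩⟩
  -- Last in the enumeration `e`, not in the order of `L`.
  obtain ⟨v, hv, hmax⟩ := Finset.exists_max_image _ e hne
  obtain ⟨s₀, hs₀, hvs₀⟩ := Finset.mem_biUnion.1 hv
  have hvA := (hsub s₀ hs₀).1 hvs₀
  refine ⟨v, hvA.1, ⟨s₀, hs₀, hvs₀⟩, ?_⟩
  set B := before A e v
  have hpz : proj B z ∈ simplexChains (B ∩ Set.Ici α) (n + 1) :=
    simplexChains_mono (Set.inter_subset_inter_right _ Set.inter_subset_right) _ (proj_mem hz)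
  -- Simplices of `z` containing `v` are killed by the cone; all others lie in `B`.
  have hcone : cone v z = cone v (proj B z) := by
    conv_lhs => rw [← Finsupp.sum_single z]
    conv_rhs => rw [← Finsupp.sum_single z]
    simp only [Finsupp.sum, map_sum]
    refine Finset.sum_congr rfl fun s hs => ?_
    by_cases hvs : v ∈ s
    · rw [proj_single_of_not_subset, map_zero, cone_single_of_mem hvs]
      exact fun h => (h hvs).2.ne rfl
    · rw [proj_single_of_subset]
      intro y hy
      have hyA := ((hsub s hs).1 hy).1
      refine ⟨hyA, lt_of_le_of_ne (hmax y (Finset.mem_biUnion.2 ⟨s, hs, hy⟩)) fun h => hvs ?_⟩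
      rwa [← he hyA hvA.1 h]
  have hz' : z = proj B z - cone v (bdry L (proj B z)) := by
    rw [← bdry_cone, ← hcone, bdry_cone, hdz, map_zero, sub_zero]
  -- Replacing each ∂x_j in a combination by x_j gives a chain `t` whose join with `v` has its
  -- boundary in the span of the new basis. The levels stay above `α` because `v`, a vertex of `z`,
  -- is at least `α`.
  have key : ∀ y ∈ Submodule.span ℤ ((fun j => bdry L (x v j)) '' {j | α ≤ lvl v j}),
      ∃ t ∈ simplexChains (B ∩ Set.Ici α) (n + 1), bdry L t = y ∧
        bdry L (cone v t) ∈ Submodule.span ℤ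
          ((fun j : Σ v : A, J v => bdry L (cone j.1.1 (x j.1 j.2))) ''
            {j | α ≤ min (lvl j.1 j.2) j.1}) := by
    intro y hy
    induction hy using Submodule.span_induction with
    | mem y hy =>
      obtain ⟨j, hj, rfl⟩ := hy
      refine ⟨x v j, simplexChains_mono ?_ _ ((H v hvA.1).mem j), rfl, Submodule.subset_span ?_⟩
      · exact fun i hi => ⟨hi.1, le_trans hj hi.2⟩
      · exact ⟨⟨⟨v, hvA.1⟩, j⟩, le_min hj hvA.2, rfl⟩
    | zero => exact ⟨0, zero_mem _, by simp, by simp⟩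
    | add y y' _ _ h h' =>
      obtain ⟨t, ht, hty, hc⟩ := h
      obtain ⟨t', ht', hty', hc'⟩ := h'
      refine ⟨t + t', add_mem ht ht', by rw [map_add, hty, hty'], ?_⟩
      rw [map_add, map_add]
      exact add_mem hc hc'
    | smul a y _ h =>
      obtain ⟨t, ht, hty, hc⟩ := h
      refine ⟨a • t, Submodule.smul_mem _ _ ht, by rw [map_smul, hty], ?_⟩
      rw [map_smul, map_smul]
      exact Submodule.smul_mem _ _ hc
  obtain ⟨t, ht, hty, hc⟩ := key _ ((H v hvA.1).span α _ hpz)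
  refine ⟨proj B z - t, sub_mem hpz ht, by rw [map_sub, hty, sub_self], ?_⟩
  have : z - (proj B z - t) = bdry L (cone v t) := by
    rw [bdry_cone, hty]
    nth_rw 1 [hz']
    abel
  rwa [this]

/-- Independence: in a relation, cutting along the predecessors of the last apex `v` leaves a
relation among the ∂x_j over `v`. Spanning: each use of `exists_reduction` moves a cycle strictly
earlier in the enumeration, so the process ends. -/
theorem isFilteredBasis_cone [WellFoundedLT W] {n : ℕ} (he : Set.InjOn e A) {J : L → Type v}
    {lvl : ∀ v, J v → L} {x : ∀ v, J v → Finset L →₀ ℤ}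
    (H : ∀ v ∈ A, IsFilteredBasis (before A e v) n (lvl v) (x v)) :
    IsFilteredBasis A (n + 1) (fun j : Σ v : A, J v => min (lvl j.1 j.2) j.1)
      (fun j => cone j.1.1 (x j.1 j.2)) where
  lvl_mem := by
    rintro ⟨v, j⟩
    rcases min_choice (lvl v j) v with h | h
    · simp only [h]; exact ((H v v.2).lvl_mem j).1
    · simp only [h]; exact v.2
  mem := by
    rintro ⟨v, j⟩
    have hv : (v : L) ∈ A ∩ Set.Ici (min (lvl v j) (v : L)) := ⟨v.2, min_le_right _ _⟩
    refine cone_mem hv (simplexChains_mono ?_ _ ((H v v.2).mem j))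
    exact fun i hi => ⟨hi.1.1, (min_le_left _ _).trans hi.2⟩
  indep := by
    classical
    rw [linearIndependent_iff]
    intro c hc
    by_contra hne
    obtain ⟨j₀, hj₀, hmax⟩ := Finset.exists_max_image c.support
      (fun j => e j.1.1) (Finsupp.support_nonempty_iff.2 hne)
    obtain ⟨v, j₀⟩ := j₀
    -- Cones with an earlier apex lie entirely on `before A e v` and vanish; those with apex `v`
    -- return their base.
    have hcut : ∀ j ∈ c.support, cut (before A e v) (bdry L (cone j.1.1 (x j.1 j.2))) =
        if j.1 = v then - bdry L (x j.1 j.2) else 0 := by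
      rintro ⟨v', j⟩ hj
      rw [cut_bdry]
      split_ifs with h
      · obtain rfl : v' = v := h
        rw [cut_cone (fun h => h.2.ne rfl)
          (simplexChains_mono Set.inter_subset_left _ ((H v' v'.2).mem j))]
      · have hlt : e v' < e v := lt_of_le_of_ne (hmax ⟨v', j⟩ hj) fun h' =>
          h (Subtype.ext (he v'.2 v.2 h'))
        rw [cut_eq_zero (k := n + 2), map_zero, neg_zero]
        have hv' : (v' : L) ∈ before A e v := ⟨v'.2, hlt⟩
        refine cone_mem hv' (simplexChains_mono ?_ _ ((H v' v'.2).mem j))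
        exact fun i hi => ⟨hi.1.1, hi.1.2.trans hlt⟩
    have h0 := congrArg (cut (before A e v)) hc
    rw [Finsupp.linearCombination_apply, Finsupp.sum, map_sum, map_zero] at h0
    have hinj : Set.InjOn (Sigma.mk (β := fun v : A => J v) v)
        (Sigma.mk (β := fun v : A => J v) v ⁻¹' c.support) := fun _ _ _ _ h => by simpa using h
    have h1 : Finsupp.linearCombination ℤ (fun j => bdry L (x v j))
        (c.comapDomain (Sigma.mk (β := fun v : A => J v) v) hinj) = 0 := by
      have := Finset.sum_preimage (Sigma.mk v) c.support hinj
        (fun j => cut (before A e v) (c j • bdry L (cone j.1.1 (x j.1 j.2)))) (by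
          rintro ⟨v', j⟩ hj hv'
          rw [map_smul, hcut _ hj, if_neg, smul_zero]
          rintro rfl
          exact hv' ⟨j, rfl⟩)
      rw [h0] at this
      rw [Finsupp.linearCombination_apply, Finsupp.sum, ← neg_eq_zero, ← this,
        ← Finset.sum_neg_distrib]
      refine Finset.sum_congr rfl fun j hj => ?_
      rw [map_smul, hcut _ (Finset.mem_preimage.1 hj), if_pos rfl, smul_neg]
      rfl
    have h2 := (linearIndependent_iff.1 (H v v.2).indep) _ h1
    have h3 := DFunLike.congr_fun h2 j₀
    rw [Finsupp.comapDomain_apply] at h3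
    exact (Finsupp.mem_support_iff.1 hj₀) h3
  span := by
    intro α z hz
    set S := Submodule.span ℤ ((fun j : Σ v : A, J v => bdry L (cone j.1.1 (x j.1 j.2))) ''
        {j | α ≤ min (lvl j.1 j.2) j.1})
    have main : ∀ w : W, ∀ v, e v = w → ∀ u ∈ simplexChains (before A e v ∩ Set.Ici α) (n + 1),
        bdry L u = 0 → u ∈ S := by
      intro w
      induction w using WellFoundedLT.induction with
      | ind w ih =>
        rintro v rfl u hu hdu
        by_cases hu0 : u = 0
        · rw [hu0]; exact zero_mem _
        obtain ⟨v', hv'A, ⟨s, hs, hv's⟩, u', hu', hdu', hmem⟩ := exists_reduction he H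
          (simplexChains_mono (Set.inter_subset_inter_left _ fun _ hi => hi.1) _ hu) hdu hu0
        have := ih (e v') ((hu hs).1 hv's).1.2 v' rfl u' hu' hdu'
        rw [← sub_add_cancel u u']
        exact add_mem hmem this
    by_cases hz0 : bdry L z = 0
    · rw [hz0]; exact zero_mem _
    -- One reduction moves the cycle `bdry L z` into an initial segment, where the well-founded
    -- induction `main` applies.
    obtain ⟨v', -, -, u', hu', hdu', hmem⟩ := exists_reduction he H (bdry_mem hz)
      (bdry_bdry z) hz0
    rw [← sub_add_cancel (bdry L z) u']
    exact add_mem hmem (main _ v' rfl u' hu' hdu')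

-- For the successor step, an injection of `A` into ω_n leaves fewer than ℵ_n elements before each
-- vertex, so the induction hypothesis supplies the bases to be coned.
open Cardinal in
theorem exists_isFilteredBasis (n : ℕ) : ∀ A : Set L, #A < ℵ_ (n : Ordinal.{v}) →
    ∃ (J : Type v) (lvl : J → L) (x : J → Finset L →₀ ℤ), IsFilteredBasis A n lvl x := by
  classical
  induction n with
  | zero =>
    intro A hA
    exact exists_isFilteredBasis_zero (lt_aleph0_iff_set_finite.1 (by simpa using hA))
  | succ n ih =>
    intro A hA
    have hA' : #A ≤ #(ℵ_ (n : Ordinal.{v})).ord.ToType := by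
      rw [mk_ord_toType]
      rwa [Nat.cast_succ, ← succ_aleph, Order.lt_succ_iff] at hA
    obtain ⟨f⟩ := hA'
    have hne : Nonempty (ℵ_ (n : Ordinal.{v})).ord.ToType := by
      rw [← mk_ne_zero_iff, mk_ord_toType]
      exact (aleph_pos _).ne'
    let e : L → (ℵ_ (n : Ordinal.{v})).ord.ToType :=
      fun y => if h : y ∈ A then f ⟨y, h⟩ else Classical.arbitrary _
    have hef : ∀ y (h : y ∈ A), e y = f ⟨y, h⟩ := fun y h => dif_pos h
    have he : Set.InjOn e A := by
      intro y hy y' hy' h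
      rw [hef y hy, hef y' hy'] at h
      exact congrArg Subtype.val (f.injective h)
    have hB : ∀ v : L, #(before A e v) < ℵ_ (n : Ordinal.{v}) := by
      intro v
      refine lt_of_le_of_lt ?_ ((mk_Iio_lt (e v) (by simp)).trans_eq (mk_ord_toType _))
      refine mk_le_of_injective (f := fun y => ⟨e y, y.2.2⟩) ?_
      intro y y' h
      exact Subtype.ext (he y.2.1 y'.2.1 (congrArg Subtype.val h))
    choose J lvl x H using fun v => ih (before A e v) (hB v)
    exact ⟨_, _, _, isFilteredBasis_cone he fun v _ => H v⟩

end Bases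

/-! ### No filtered splitting exists over sufficiently cofinal sets. -/

section Sections

variable {L : Type v} [LinearOrder L]

/-- A filtration preserving splitting of the boundary map `d_n`, written as a map `φ` on the
`n`-simplices with vertices in `C` which depends only on their boundary. Its values are chains
on `D`. -/
structure IsSplitting (D C : Set L) (n : ℕ) (φ : (Finset L →₀ ℤ) →ₗ[ℤ] (Finset L →₀ ℤ)) :
    Prop where
  mem : ∀ α, ∀ x ∈ simplexChains (C ∩ Set.Ici α) (n + 1),
    φ x ∈ simplexChains (D ∩ Set.Ici α) (n + 1)
  bdry_map : ∀ x ∈ simplexChains C (n + 1), bdry L (φ x) = bdry L x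
  map_eq_zero : ∀ x ∈ simplexChains C (n + 1), bdry L x = 0 → φ x = 0

theorem IsSplitting.map_eq_map {D C : Set L} {n : ℕ}
    {φ : (Finset L →₀ ℤ) →ₗ[ℤ] (Finset L →₀ ℤ)} (h : IsSplitting D C n φ)
    {x y : Finset L →₀ ℤ} (hx : x ∈ simplexChains C (n + 1)) (hy : y ∈ simplexChains C (n + 1))
    (hxy : bdry L x = bdry L y) : φ x = φ y := by
  rw [← sub_eq_zero, ← map_sub]
  exact h.map_eq_zero _ (sub_mem hx hy) (by rw [map_sub, hxy, sub_self])

open Cardinal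

/-- Families of fewer than `κ` elements of `D` have strict upper bounds in `C`. -/
def IsCofinalFor (κ : Cardinal.{u}) (D C : Set L) : Prop :=
  ∀ (ι : Type u) (f : ι → L), #ι < κ → (∀ i, f i ∈ D) → ∃ c ∈ C, ∀ i, f i < c

theorem IsCofinalFor.nonempty {κ : Cardinal.{u}} {D C : Set L} (hC : IsCofinalFor κ D C)
    (hκ : 0 < κ) : C.Nonempty := by
  obtain ⟨c, hc, -⟩ := hC PEmpty PEmpty.elim (by rwa [mk_pempty]) (fun i => i.elim)
  exact ⟨c, hc⟩

/-- All vertices in `C` share one boundary, hence one value of φ. A vertex `i` in its support would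
lie above some `c' > i` in `C`, so the value is 0, though its boundary is ⟨∅⟩. -/
theorem not_isSplitting_zero {D C : Set L} (hC : IsCofinalFor.{u} (ℵ₀ : Cardinal.{u}) D C)
    (φ : (Finset L →₀ ℤ) →ₗ[ℤ] (Finset L →₀ ℤ)) : ¬ IsSplitting D C 0 φ := by
  intro h
  have hb : ∀ i : L, bdry L (Finsupp.single {i} 1) = Finsupp.single ∅ 1 := by
    intro i
    simp [bdry_single, vertexSign, Finset.filter_singleton]
  have hs : ∀ i ∈ C, Finsupp.single {i} 1 ∈ simplexChains C (0 + 1) := fun i hi =>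
    single_mem_simplexChains (by simpa using hi) (by simp) 1
  obtain ⟨c, hc⟩ := hC.nonempty aleph0_pos
  have h0 : φ (Finsupp.single {c} 1) = 0 := by
    rw [← Finsupp.support_eq_empty, Finset.eq_empty_iff_forall_notMem]
    intro s hs'
    have hsub := h.mem c _ (single_mem_simplexChains (by simpa using hc) (by simp) 1) hs'
    obtain ⟨i, rfl⟩ := Finset.card_eq_one.1 hsub.2
    obtain ⟨c', hc', hlt⟩ := hC PUnit (fun _ => i) (by simp) (fun _ => (hsub.1 (by simp)).1)
    rw [h.map_eq_map (hs c hc) (hs c' hc') (by rw [hb, hb])] at hs'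
    have hsub' := h.mem c' _ (single_mem_simplexChains (by simpa using hc') (by simp) 1) hs'
    exact (hlt PUnit.unit).not_ge (hsub'.1 (by simp)).2
  have h1 := h.bdry_map _ (hs c hc)
  rw [h0, map_zero, hb] at h1
  exact one_ne_zero (Finsupp.single_eq_zero.1 h1.symm)

/-- Passing from a splitting in dimension `n + 1` to one in dimension `n`, for a lower subset `D'`
of `D` such that `φ` maps chains on `C'` to chains on `D'`. -/
theorem IsSplitting.descend {D C D' C' : Set L} {n : ℕ}
    {φ : (Finset L →₀ ℤ) →ₗ[ℤ] (Finset L →₀ ℤ)} (h : IsSplitting D C (n + 1) φ)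
    (hCC' : C' ⊆ C) (hD' : C' ⊆ D') (hne : C'.Nonempty) {δ : L} (hδ : δ ∈ C)
    (hδD : ∀ i ∈ D', i < δ)
    (hφ : ∀ x ∈ simplexChains C' (n + 2), φ x ∈ simplexChains D' (n + 2)) :
    IsSplitting D' C' n (cut D' ∘ₗ φ ∘ₗ cone δ) := by
  have hδ' : δ ∉ D' := fun h => (hδD δ h).false
  have hcone : ∀ x ∈ simplexChains C' (n + 1), cone δ x ∈ simplexChains C (n + 2) :=
    fun x hx => cone_mem hδ (simplexChains_mono hCC' _ hx)
  refine ⟨fun α x hx => ?_, fun x hx => ?_, fun x hx hdx => ?_⟩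
  · by_cases hα : (C' ∩ Set.Ici α).Nonempty
    · obtain ⟨i, hi, hαi⟩ := hα
      have hδα : δ ∈ C ∩ Set.Ici α := ⟨hδ, le_trans hαi (hδD i (hD' hi)).le⟩
      have := cut_mem (A := D') (h.mem α _ (cone_mem hδα
        (simplexChains_mono (Set.inter_subset_inter_left _ hCC') _ hx)))
      exact simplexChains_mono (Set.inter_subset_inter_right _ Set.inter_subset_right) _ this
    · have hx0 : x = 0 := by
        rw [← Finsupp.support_eq_empty, Finset.eq_empty_iff_forall_notMem]
        intro s hs
        have hs' := hx hs
        obtain ⟨i, hi⟩ := Finset.card_pos.1 (by rw [hs'.2]; omega : 0 < s.card)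
        exact hα ⟨i, hs'.1 hi⟩
      rw [hx0, map_zero]; exact zero_mem _
  · have hx' : x ∈ simplexChains D' (n + 1) := simplexChains_mono hD' _ hx
    -- ∂φ(δ∗x) = ∂(δ∗x) = x − δ∗∂x, and cutting this leaves −∂x; the sign cancels that of
    -- `cut_bdry`.
    have h1 := cut_bdry D' (φ (cone δ x))
    rw [h.bdry_map _ (hcone x hx), bdry_cone, map_sub, cut_eq_zero hx',
      cut_cone hδ' (bdry_mem hx'), zero_sub, neg_inj] at h1
    exact h1.symm
  · obtain ⟨a, ha⟩ := hne
    have hax : cone a x ∈ simplexChains C' (n + 2) := cone_mem ha hx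
    -- Both cones bound the cycle `x`, so δ may be traded for a vertex of `C'`; the value then lies
    -- on `D'` and the cut kills it.
    have : φ (cone δ x) = φ (cone a x) :=
      h.map_eq_map (hcone x hx) (simplexChains_mono hCC' _ hax) (by
        rw [bdry_cone, bdry_cone, hdx]; simp)
    rw [LinearMap.comp_apply, LinearMap.comp_apply, this, cut_eq_zero (hφ _ hax)]

/-- Well-founded recursion: stage `ξ` must exceed `F` on all finite sets of earlier values, and
there are fewer than `κ` of these. -/
theorem exists_strictly_bounding {κ : Cardinal.{u}} {D C : Set L} (hC : IsCofinalFor κ D C)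
    {W : Type u} [LinearOrder W] [WellFoundedLT W] (hW : ∀ ξ : W, #(Finset (Set.Iio ξ)) < κ)
    (F : Finset L → L) (hF : ∀ s : Finset L, (s : Set L) ⊆ C → F s ∈ D) :
    ∃ c : W → L, (∀ ξ, c ξ ∈ C) ∧
      ∀ ξ, ∀ t : Finset W, (∀ η ∈ t, η < ξ) → F (t.image c) < c ξ := by
  classical
  have step : ∀ ξ : W, ∀ p : (∀ η, η < ξ → C), ∃ c : C, ∀ t : Finset (Set.Iio ξ),
      F (t.image fun η => (p η.1 η.2 : L)) < c := by
    intro ξ p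
    have hp : ∀ t : Finset (Set.Iio ξ), F (t.image fun η => (p η.1 η.2 : L)) ∈ D := by
      refine fun t => hF _ fun y hy => ?_
      obtain ⟨η, -, rfl⟩ := Finset.mem_image.1 hy
      exact (p η.1 η.2).2
    obtain ⟨c, hc, h⟩ := hC _ _ (hW ξ) hp
    exact ⟨⟨c, hc⟩, h⟩
  choose G hG using step
  let c : W → C := WellFoundedLT.fix (motive := fun _ => C) G
  have hc : ∀ ξ, c ξ = G ξ fun η _ => c η := fun ξ => WellFoundedLT.fix_eq _ ξ
  refine ⟨fun ξ => c ξ, fun ξ => (c ξ).2, fun ξ t ht => ?_⟩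
  have := hG ξ (fun η _ => c η) (t.subtype (· ∈ Set.Iio ξ))
  rw [← hc ξ] at this
  convert this using 2
  ext y
  simp only [Finset.mem_image, Finset.mem_subtype, Subtype.exists, Set.mem_Iio]
  constructor
  · rintro ⟨η, hη, rfl⟩
    exact ⟨η, ht η hη, hη, rfl⟩
  · rintro ⟨η, _, hη, rfl⟩
    exact ⟨η, hη, rfl⟩

/-- The induction needs two sets because descent replaces `C` by the range of a sequence and `D` by
its downward closure. Regularity of ℵ_n gives the new pair its cofinality. -/
theorem not_isSplitting (n : ℕ) : ∀ D C : Set L,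
    IsCofinalFor (ℵ_ (n : Ordinal.{u})) D C → C ⊆ D →
    ∀ φ : (Finset L →₀ ℤ) →ₗ[ℤ] (Finset L →₀ ℤ), ¬ IsSplitting D C n φ := by
  classical
  induction n with
  | zero =>
    intro D C hC hCD φ
    exact not_isSplitting_zero (by simpa using hC) φ
  | succ n ih =>
    intro D C hC hCD φ h
    set κ : Cardinal.{u} := ℵ_ (n : Ordinal.{u}) with hκ
    have hκ0 : ℵ₀ ≤ κ := aleph0_le_aleph _
    have hκlt : κ < ℵ_ ((n + 1 : ℕ) : Ordinal.{u}) := by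
      rw [hκ, aleph_lt_aleph]; exact_mod_cast Nat.lt_succ_self n
    have hκreg : κ.IsRegular := by
      rw [hκ]
      cases n with
      | zero => simpa using isRegular_aleph0
      | succ m => rw [Nat.cast_succ]; exact isRegular_aleph_add_one _
    let W := κ.ord.ToType
    have hWc : #W = κ := mk_ord_toType κ
    have hWinf : Infinite W := by rw [infinite_iff, hWc]; exact hκ0
    have hWfin : #(Finset W) = κ := by rw [mk_finset_of_infinite, hWc]
    have hbdd : ∀ (ι : Type u) (f : ι → W), #ι < κ → ∃ ξ, ∀ i, f i < ξ := by
      intro ι f hι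
      by_contra! hno
      have hcof : IsCofinal (Set.range f) := fun ξ => by
        obtain ⟨i, hi⟩ := hno ξ
        exact ⟨f i, ⟨i, rfl⟩, hi⟩
      refine ((Order.cof_le hcof).trans mk_range_le).not_gt ?_
      rwa [Ordinal.cof_toType, hκreg.cof_ord]
    -- An element of `D` bounding `s` and the vertices of the chain `φ ⟨s⟩`.
    have hF : ∀ s : Finset L, ∃ b : L, (s : Set L) ⊆ C → b ∈ D ∧ (∀ i ∈ s, i ≤ b) ∧
        (s.card = n + 2 → ∀ t ∈ (φ (Finsupp.single s 1)).support, ∀ i ∈ t, i ≤ b) := by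
      intro s
      by_cases hs : (s : Set L) ⊆ C
      swap
      · obtain ⟨c, -⟩ := hC.nonempty (aleph_pos _)
        exact ⟨c, fun h => (hs h).elim⟩
      let V : Finset L := s ∪ if s.card = n + 2 then
        (φ (Finsupp.single s 1)).support.biUnion id else ∅
      have hV : ∀ i ∈ V, i ∈ D := by
        intro i hi
        rcases Finset.mem_union.1 hi with hi | hi
        · exact hCD (hs hi)
        · split_ifs at hi with hcard
          · obtain ⟨t, ht, hit⟩ := Finset.mem_biUnion.1 hi
            have hne : s.Nonempty := Finset.card_pos.1 (by omega)
            -- `L` need not have a least element, so the minimum of `s` serves as the filtration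
            -- level.
            have := h.mem (s.min' hne) _ (single_mem_simplexChains
              (Set.subset_inter hs fun j hj => s.min'_le j hj) hcard 1) ht
            exact (this.1 hit).1
          · simp at hi
      obtain ⟨b, hb, hVb⟩ := hC (ULift.{u} (Fin V.card))
        (fun k => V.orderEmbOfFin rfl k.down) (by
          exact (lt_aleph0_of_finite _).trans_le (aleph0_le_aleph _))
        (fun k => hV _ (V.orderEmbOfFin_mem rfl _))
      have hVb' : ∀ i ∈ V, i ≤ b := by
        intro i hi
        have : i ∈ Set.range (V.orderEmbOfFin rfl) := by
          rw [Finset.range_orderEmbOfFin]; exact hi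
        obtain ⟨k, rfl⟩ := this
        exact (hVb ⟨k⟩).le
      refine ⟨b, fun _ => ⟨hCD hb, fun i hi => hVb' i (Finset.mem_union_left _ hi),
        fun hcard t ht i hi => hVb' i (Finset.mem_union_right _ ?_)⟩⟩
      rw [if_pos hcard]
      exact Finset.mem_biUnion.2 ⟨t, ht, hi⟩
    choose F hF using hF
    obtain ⟨c, hcC, hcF⟩ := exists_strictly_bounding hC (W := W) (fun ξ =>
      (mk_le_of_injective (Finset.map_injective (Function.Embedding.subtype _))).trans_lt
        (hWfin.trans_lt hκlt)) F (fun s hs => (hF s hs).1)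
    -- A finite set of sequence terms is indexed below some `ξ`, so the bound `F` keeps the vertices
    -- of its φ-value below `c ξ`, hence in `D'`.
    set D' : Set L := {i | ∃ ξ, i ≤ c ξ}
    have hCD' : Set.range c ⊆ D' := by rintro _ ⟨ξ, rfl⟩; exact ⟨ξ, le_rfl⟩
    have hcC' : Set.range c ⊆ C := by rintro _ ⟨ξ, rfl⟩; exact hcC ξ
    obtain ⟨δ, hδ, hδc⟩ := hC W c (hWc.trans_lt hκlt) (fun ξ => hCD (hcC ξ))
    have hmono : ∀ η ξ, η < ξ → c η < c ξ := by
      intro η ξ hlt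
      refine lt_of_le_of_lt ?_ (hcF ξ {η} (by simpa using hlt))
      refine (hF _ ?_).2.1 _ (by simp)
      simpa using hcC η
    refine ih D' (Set.range c) ?_ hCD' _ (h.descend hcC' hCD' ⟨_, ⟨hWinf.nonempty.some, rfl⟩⟩ hδ
      ?_ ?_)
    · intro ι f hι hf
      choose g hg using hf
      obtain ⟨ξ, hξ⟩ := hbdd ι g hι
      exact ⟨c ξ, ⟨ξ, rfl⟩, fun i => (hg i).trans_lt (hmono _ _ (hξ i))⟩
    · rintro i ⟨ξ, hi⟩
      exact hi.trans_lt (hδc ξ)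
    · intro x hx
      refine map_mem_of_mem_simplexChains (fun s hs hk => ?_) hx
      obtain ⟨t, rfl⟩ : ∃ t : Finset W, t.image c = s := by
        obtain ⟨t, -, ht⟩ := Finset.subset_set_image_iff.1 (by simpa using hs :
          (s : Set L) ⊆ c '' Set.univ)
        exact ⟨t, ht⟩
      obtain ⟨ξ, hξ⟩ := hbdd (ULift.{u} t) (fun η => η.down.1)
        ((lt_aleph0_of_finite _).trans_le hκ0)
      have hFt := hF _ (hs.trans hcC')
      have hlt := hcF ξ t (fun η hη => hξ ⟨⟨η, hη⟩⟩)
      intro r hr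
      refine ⟨fun i hi => ⟨ξ, ((hFt.2.2 hk r hr i hi).trans hlt.le)⟩, ?_⟩
      have hne : (t.image c).Nonempty := Finset.card_pos.1 (by omega)
      exact (h.mem ((t.image c).min' hne) _ (single_mem_simplexChains (Set.subset_inter
        (hs.trans hcC') fun j hj => Finset.min'_le _ j hj) hk 1) hr).2

end Sections

/-! ### From tuples and inverse systems to finite sets and filtered boundaries. -/

section Translation

/-- The set of coordinates of a tuple. -/
def Tuples.toFinset {A : Set Ordinal.{u}} {k : ℕ} (σ : Tuples A k) : Finset Ordinal.{u} :=
  Finset.univ.map (σ.toEmbedding.trans (Function.Embedding.subtype _))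

theorem Tuples.coe_toFinset {A : Set Ordinal.{u}} {k : ℕ} (σ : Tuples A k) :
    (σ.toFinset : Set Ordinal.{u}) = Subtype.val '' Set.range σ := by
  ext i; simp [Tuples.toFinset]

theorem Tuples.toFinset_injective {A : Set Ordinal.{u}} {k : ℕ} :
    Function.Injective (Tuples.toFinset : Tuples A k → Finset Ordinal.{u}) := by
  intro σ τ h
  have h' := congrArg (fun s : Finset Ordinal.{u} => (s : Set Ordinal.{u})) h
  simp only [Tuples.coe_toFinset] at h'
  exact OrderEmbedding.range_inj.1 (Subtype.val_injective.image_injective h')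

theorem Tuples.toFinset_subset {A : Set Ordinal.{u}} {k : ℕ} (σ : Tuples A k) :
    (σ.toFinset : Set Ordinal.{u}) ⊆ A := by
  rw [Tuples.coe_toFinset]
  rintro _ ⟨i, -, rfl⟩
  exact i.2

theorem Tuples.card_toFinset {A : Set Ordinal.{u}} {k : ℕ} (σ : Tuples A k) :
    σ.toFinset.card = k := by
  simp [Tuples.toFinset]

theorem Tuples.exists_toFinset_eq {A : Set Ordinal.{u}} {k : ℕ} {s : Finset Ordinal.{u}}
    (hs : (s : Set Ordinal.{u}) ⊆ A) (hk : s.card = k) : ∃ σ : Tuples A k, σ.toFinset = s := by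
  refine ⟨OrderEmbedding.ofStrictMono
    (fun i => ⟨s.orderEmbOfFin hk i, hs (s.orderEmbOfFin_mem hk i)⟩)
    fun i j hij => (s.orderEmbOfFin hk).strictMono hij, ?_⟩
  rw [← Finset.coe_inj, Tuples.coe_toFinset, ← Set.range_comp]
  exact Finset.range_orderEmbOfFin s hk

theorem Tuples.toFinset_incl {A A' : Set Ordinal.{u}} (h : A ⊆ A') {k : ℕ} (σ : Tuples A k) :
    (σ.incl h).toFinset = σ.toFinset := rfl

theorem Tuples.toFinset_face {A : Set Ordinal.{u}} {k : ℕ} (σ : Tuples A (k + 1))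
    (i : Fin (k + 1)) : (σ.face i).toFinset = σ.toFinset.erase (σ i) := by
  rw [← Finset.coe_inj, Finset.coe_erase, Tuples.coe_toFinset, Tuples.coe_toFinset]
  ext y
  simp only [Tuples.face, Set.mem_image, Set.mem_range, Set.mem_sdiff, Set.mem_singleton_iff]
  constructor
  · rintro ⟨_, ⟨j, rfl⟩, rfl⟩
    refine ⟨⟨_, ⟨_, rfl⟩, rfl⟩, fun h => ?_⟩
    exact Fin.succAbove_ne i j (σ.injective (Subtype.ext h))
  · rintro ⟨⟨_, ⟨j, rfl⟩, rfl⟩, h⟩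
    obtain ⟨j, rfl⟩ := Fin.exists_succAbove_eq (y := i) (x := j) fun h' => h (by rw [h'])
    exact ⟨_, ⟨j, rfl⟩, rfl⟩

theorem Tuples.vertexSign_toFinset {A : Set Ordinal.{u}} {k : ℕ} (σ : Tuples A k)
    (i : Fin k) : vertexSign (σ i : Ordinal.{u}) σ.toFinset = (-1) ^ (i : ℕ) := by
  unfold vertexSign Tuples.toFinset
  rw [Finset.filter_map, Finset.card_map]
  congr 1
  have : Finset.univ.filter ((fun x : Ordinal.{u} => x < σ i) ∘
      (σ.toEmbedding.trans (Function.Embedding.subtype _))) = Finset.Iio i := by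
    ext j
    simp
  rw [this, Fin.card_Iio]

/-- Chains of tuples as chains of finite sets. -/
noncomputable def toSimplexChain (A : Set Ordinal.{u}) (k : ℕ) :
    Chains A k →ₗ[ℤ] (Finset Ordinal.{u} →₀ ℤ) :=
  Finsupp.lmapDomain ℤ ℤ Tuples.toFinset

theorem toSimplexChain_single {A : Set Ordinal.{u}} {k : ℕ} (σ : Tuples A k) (z : ℤ) :
    toSimplexChain A k (Finsupp.single σ z) = Finsupp.single σ.toFinset z := by
  simp [toSimplexChain]

theorem toSimplexChain_injective (A : Set Ordinal.{u}) (k : ℕ) :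
    Function.Injective (toSimplexChain A k) :=
  Finsupp.mapDomain_injective Tuples.toFinset_injective

theorem range_toSimplexChain (A : Set Ordinal.{u}) (k : ℕ) :
    LinearMap.range (toSimplexChain A k) = simplexChains A k := by
  apply le_antisymm
  · rintro _ ⟨x, rfl⟩
    induction x using Finsupp.induction_linear with
    | zero => simp
    | add x y hx hy => rw [map_add]; exact add_mem hx hy
    | single σ z =>
      rw [toSimplexChain_single]
      exact single_mem_simplexChains σ.toFinset_subset σ.card_toFinset z
  · refine simplexChains_le fun s hs hk => ?_
    obtain ⟨σ, rfl⟩ := Tuples.exists_toFinset_eq hs hk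
    exact ⟨Finsupp.single σ 1, toSimplexChain_single σ 1⟩

theorem toSimplexChain_chainsIncl {A A' : Set Ordinal.{u}} (h : A ⊆ A') (k : ℕ)
    (x : Chains A k) : toSimplexChain A' k (chainsIncl h k x) = toSimplexChain A k x := by
  induction x using Finsupp.induction_linear with
  | zero => simp
  | add x y hx hy => simp only [map_add, hx, hy]
  | single σ z =>
    rw [chainsIncl_single, toSimplexChain_single, toSimplexChain_single, Tuples.toFinset_incl]

theorem toSimplexChain_boundary {A : Set Ordinal.{u}} {n : ℕ} (x : Chains A (n + 1)) :
    toSimplexChain A n (boundary A n x) = bdry Ordinal.{u} (toSimplexChain A (n + 1) x) := by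
  induction x using Finsupp.induction_linear with
  | zero => simp
  | add x y hx hy => simp only [map_add, hx, hy]
  | single σ z =>
    rw [boundary_single, toSimplexChain_single, bdry_single, map_zsmul, map_sum]
    congr 1
    nth_rw 1 [Tuples.toFinset]
    rw [Finset.sum_map]
    refine Finset.sum_congr rfl fun i _ => ?_
    rw [toSimplexChain_single, Tuples.toFinset_face, ← Tuples.vertexSign_toFinset]
    rfl

variable {n : ℕ} {ε : Ordinal.{u}}

/-- The terms of `d_n P_n(ε)` as groups of chains of finite sets. -/
noncomputable def dPVal (n : ℕ) {ε : Ordinal.{u}} (α : Set.Iio ε) :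
    (dP n ε).term α →ₗ[ℤ] (Finset Ordinal.{u} →₀ ℤ) :=
  ((toSimplexChain (Set.Ico (α : Ordinal.{u}) ε) n).toAddMonoidHom.comp
    ((d n ε).app (op α)).hom.range.subtype).toIntLinearMap

theorem dPVal_injective (α : Set.Iio ε) : Function.Injective (dPVal n α) :=
  (toSimplexChain_injective _ _).comp Subtype.val_injective

theorem dPVal_bond {α β : Set.Iio ε} (h : α ≤ β) (y : (dP n ε).term β) :
    dPVal n α ((dP n ε).bond h y) = dPVal n β y :=
  toSimplexChain_chainsIncl (Set.Ico_subset_Ico_left h) n y.1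

theorem exists_dPVal_eq (α : Set.Iio ε) {x : Finset Ordinal.{u} →₀ ℤ}
    (hx : x ∈ simplexChains (Set.Ico (α : Ordinal.{u}) ε) (n + 1)) :
    ∃ y, dPVal n α y = bdry Ordinal.{u} x := by
  rw [← range_toSimplexChain] at hx
  obtain ⟨c, rfl⟩ := hx
  exact ⟨⟨boundary _ n c, c, rfl⟩, toSimplexChain_boundary c⟩

theorem exists_eq_dPVal (α : Set.Iio ε) (y : (dP n ε).term α) :
    ∃ x ∈ simplexChains (Set.Ico (α : Ordinal.{u}) ε) (n + 1),
      bdry Ordinal.{u} x = dPVal n α y := by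
  obtain ⟨_, c, rfl⟩ := y
  refine ⟨toSimplexChain _ _ c, ?_, (toSimplexChain_boundary c).symm⟩
  rw [← range_toSimplexChain]
  exact ⟨c, rfl⟩

theorem dPVal_sum {α : Set.Iio ε} {B : Set (Σ j : Set.Iio ε, (dP n ε).term j)}
    (a : {b : Σ j : Set.Iio ε, (dP n ε).term j // b ∈ B ∧ α ≤ b.1} →₀ ℤ) :
    dPVal n α (a.sum fun b z => z • (dP n ε).bond b.2.2 b.1.2) =
      Finsupp.linearCombination ℤ (fun b : {b : Σ j : Set.Iio ε, (dP n ε).term j //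
        b ∈ B ∧ α ≤ b.1} => dPVal n b.1.1 b.1.2) a := by
  rw [Finsupp.linearCombination_apply, Finsupp.sum, Finsupp.sum, map_sum]
  refine Finset.sum_congr rfl fun b _ => ?_
  rw [map_smul, dPVal_bond]

theorem IsFilteredBasis.isFree {J : Type w} {lvl : J → Ordinal.{u}}
    {x : J → Finset Ordinal.{u} →₀ ℤ} (h : IsFilteredBasis (Set.Iio ε) n lvl x) :
    (dP n ε).IsFree := by
  have hIco : ∀ α : Ordinal.{u}, Set.Iio ε ∩ Set.Ici α = Set.Ico α ε := fun α => by
    rw [Set.inter_comm]; rfl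
  have hx : ∀ j, ∃ y : (dP n ε).term ⟨lvl j, h.lvl_mem j⟩,
      dPVal n ⟨lvl j, h.lvl_mem j⟩ y = bdry Ordinal.{u} (x j) := fun j =>
    exists_dPVal_eq _ (by rw [← hIco]; exact h.mem j)
  choose y hy using hx
  let b : J → Σ j : Set.Iio ε, (dP n ε).term j := fun j => ⟨⟨lvl j, h.lvl_mem j⟩, y j⟩
  refine ⟨Set.range b, fun α z => ?_⟩
  let f : {c : Σ j : Set.Iio ε, (dP n ε).term j // c ∈ Set.range b ∧ α ≤ c.1} →
      Finset Ordinal.{u} →₀ ℤ := fun c => dPVal n c.1.1 c.1.2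
  have hf : LinearIndependent ℤ f := by
    choose g hg using fun c : {c : Σ j : Set.Iio ε, (dP n ε).term j //
      c ∈ Set.range b ∧ α ≤ c.1} => c.2.1
    have hfg : f = (fun j => bdry Ordinal.{u} (x j)) ∘ g := by
      funext c
      rw [Function.comp_apply, ← hy (g c)]
      change dPVal n c.1.1 c.1.2 = dPVal n (b (g c)).1 (b (g c)).2
      rw [hg c]
    rw [hfg]
    refine h.indep.comp g fun c c' hcc => Subtype.ext ?_
    rw [← hg c, ← hg c', hcc]
  obtain ⟨t, ht, htz⟩ := exists_eq_dPVal α z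
  have hspan : dPVal n α z ∈ Submodule.span ℤ (Set.range f) := by
    rw [← htz]
    refine Submodule.span_mono ?_ (h.span α t (by rw [hIco]; exact ht))
    rintro _ ⟨j, hj, rfl⟩
    exact ⟨⟨b j, ⟨j, rfl⟩, hj⟩, hy j⟩
  obtain ⟨a, ha⟩ := Finsupp.mem_span_range_iff_exists_finsupp.1 hspan
  refine ⟨a, dPVal_injective α ?_, fun a' ha' => hf ?_⟩
  · rw [dPVal_sum, ← ha]; rfl
  · rw [← dPVal_sum, ← ha', ← ha]; rfl

/-- A free basis allows a choice of preimage under the boundary for each basis element, at its own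
level. Extending linearly over the term at index 0 gives a section, and composing it with the
boundary gives φ. -/
theorem exists_isSplitting_of_isFree (hε : 0 < ε) (h : (dP n ε).IsFree) :
    ∃ φ, IsSplitting (Set.Iio ε) (Set.Iio ε) n φ := by
  classical
  obtain ⟨B, hB⟩ := h
  have hIco : ∀ α : Ordinal.{u}, Set.Iio ε ∩ Set.Ici α = Set.Ico α ε := fun α => by
    rw [Set.inter_comm]; rfl
  have hIio : Set.Iio ε = Set.Ico 0 ε := by rw [← hIco]; ext; simp
  let o : Set.Iio ε := ⟨0, hε⟩
  have ho : ∀ α : Set.Iio ε, o ≤ α := fun α => zero_le (a := (α : Ordinal.{u}))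
  choose p hp hpb using fun b : {b : Σ j : Set.Iio ε, (dP n ε).term j // b ∈ B ∧ o ≤ b.1} =>
    exists_eq_dPVal b.1.1 b.1.2
  let f : {b : Σ j : Set.Iio ε, (dP n ε).term j // b ∈ B ∧ o ≤ b.1} → (dP n ε).term o :=
    fun b => (dP n ε).bond b.2.2 b.1.2
  have hbij : Function.Bijective (Finsupp.linearCombination ℤ f) := by
    refine ⟨fun a a' haa => ?_, fun z => ?_⟩
    · obtain ⟨a₀, -, h₀⟩ := hB o (Finsupp.linearCombination ℤ f a)
      rw [h₀ a rfl, h₀ a' (haa.trans rfl)]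
    · obtain ⟨a, ha, -⟩ := hB o z
      exact ⟨a, ha.symm⟩
  let E := LinearEquiv.ofBijective _ hbij
  let F : (dP n ε).term o →ₗ[ℤ] (Finset Ordinal.{u} →₀ ℤ) :=
    Finsupp.linearCombination ℤ p ∘ₗ E.symm.toLinearMap
  have hF : ∀ a, F (Finsupp.linearCombination ℤ f a) = Finsupp.linearCombination ℤ p a := by
    intro a
    change Finsupp.linearCombination ℤ p (E.symm (E a)) = _
    rw [E.symm_apply_apply]
  have hFb : ∀ z, bdry Ordinal.{u} (F z) = dPVal n o z := by
    intro z
    obtain ⟨a, rfl⟩ := hbij.2 z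
    rw [hF]
    induction a using Finsupp.induction_linear with
    | zero => simp
    | add a a' ha ha' => simp only [map_add, ha, ha']
    | single b z =>
      rw [Finsupp.linearCombination_single, Finsupp.linearCombination_single, map_smul, map_smul,
        hpb, dPVal_bond]
  -- Here freeness is used at `α`, not only at 0: an element of the term at `α` involves only basis
  -- elements of level at least `α`.
  have hFm : ∀ (α : Set.Iio ε) (z : (dP n ε).term α),
      F ((dP n ε).bond (ho α) z) ∈ simplexChains (Set.Ico (α : Ordinal.{u}) ε) (n + 1) := by
    intro α z
    obtain ⟨a, rfl, -⟩ := hB α z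
    rw [Finsupp.sum, map_sum, map_sum]
    refine Submodule.sum_mem _ fun b _ => ?_
    have hb : (dP n ε).bond (ho α) ((dP n ε).bond b.2.2 b.1.2) =
        Finsupp.linearCombination ℤ f (Finsupp.single ⟨b.1, b.2.1, ho _⟩ 1) := by
      apply dPVal_injective
      rw [Finsupp.linearCombination_single, one_smul, dPVal_bond, dPVal_bond, dPVal_bond]
    rw [map_zsmul, map_zsmul, hb, hF, Finsupp.linearCombination_single, one_smul]
    refine zsmul_mem ?_ _
    have hαb : (α : Ordinal.{u}) ≤ b.1.1 := b.2.2
    exact simplexChains_mono (Set.Ico_subset_Ico_left hαb) _ (hp ⟨b.1, b.2.1, ho _⟩)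
  have hg : ∀ s : Finset Ordinal.{u}, ∃ y : (dP n ε).term o,
      (s : Set Ordinal.{u}) ⊆ Set.Iio ε → s.card = n + 1 →
        dPVal n o y = bdry Ordinal.{u} (Finsupp.single s 1) := by
    intro s
    by_cases hs : (s : Set Ordinal.{u}) ⊆ Set.Iio ε ∧ s.card = n + 1
    · obtain ⟨y, hy⟩ := exists_dPVal_eq o (single_mem_simplexChains (hIio ▸ hs.1) hs.2 1)
      exact ⟨y, fun _ _ => hy⟩
    · exact ⟨0, fun h h' => (hs ⟨h, h'⟩).elim⟩
  choose g₀ hg₀ using hg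
  let g : (Finset Ordinal.{u} →₀ ℤ) →ₗ[ℤ] (dP n ε).term o := Finsupp.linearCombination ℤ g₀
  have hg : ∀ x ∈ simplexChains (Set.Iio ε) (n + 1), dPVal n o (g x) = bdry Ordinal.{u} x := by
    intro x hx
    refine map_eq_map_of_mem_simplexChains (f := dPVal n o ∘ₗ g) (fun s hs hk => ?_) hx
    rw [LinearMap.comp_apply, Finsupp.linearCombination_single, one_smul, hg₀ s hs hk]
  refine ⟨F ∘ₗ g, fun α x hx => ?_, fun x hx => ?_, fun x hx hdx => ?_⟩
  · by_cases hα : α < ε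
    · rw [hIco] at hx ⊢
      obtain ⟨y, hy⟩ := exists_dPVal_eq ⟨α, hα⟩ hx
      have : g x = (dP n ε).bond (ho ⟨α, hα⟩) y := by
        apply dPVal_injective
        rw [dPVal_bond, hy, hg x (simplexChains_mono Set.Ico_subset_Iio_self _ hx)]
      rw [LinearMap.comp_apply, this]
      exact hFm _ y
    · rw [hIco] at hx ⊢
      have hx0 : x = 0 := by
        rw [← Finsupp.support_eq_empty, Finset.eq_empty_iff_forall_notMem]
        intro s hs
        have hs' := hx hs
        obtain ⟨i, hi⟩ := Finset.card_pos.1 (by rw [hs'.2]; omega : 0 < s.card)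
        have := hs'.1 hi
        exact hα (this.1.trans_lt this.2)
      rw [hx0, map_zero]; exact zero_mem _
  · rw [LinearMap.comp_apply, hFb, hg x hx]
  · have : g x = 0 := by
      apply dPVal_injective
      rw [hg x hx, hdx, map_zero]
    rw [LinearMap.comp_apply, this, map_zero]

open Cardinal in
theorem isCofinalFor_Iio_omega (n : ℕ) :
    IsCofinalFor (ℵ_ (n : Ordinal.{u})) (Set.Iio (ω_ (n : Ordinal.{u})))
      (Set.Iio (ω_ (n : Ordinal.{u}))) := by
  intro ι f hι hf
  have hκreg : (ℵ_ (n : Ordinal.{u})).IsRegular := by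
    cases n with
    | zero => simpa using isRegular_aleph0
    | succ m => rw [Nat.cast_succ]; exact isRegular_aleph_add_one _
  have hcof : (ω_ (n : Ordinal.{u})).cof = ℵ_ (n : Ordinal.{u}) := by
    rw [← ord_aleph, hκreg.cof_ord]
  have hlim : Order.IsSuccLimit (ω_ (n : Ordinal.{u})) := Cardinal.isSuccLimit_omega _
  refine ⟨Order.succ (⨆ i, f i), hlim.succ_lt (Ordinal.iSup_lt_of_lt_cof (by rwa [hcof]) hf),
    fun i => Order.lt_succ_of_le (Ordinal.le_iSup f i)⟩

end Translation

end OrdinalSystems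

theorem mainTheorem2 (n : ℕ) (hn : 1 ≤ n) :
    IsLeast {ε : Ordinal.{u} | ¬ (OrdinalSystems.dP n ε).IsFree} (ω_ (n : Ordinal.{u})) := by
  refine ⟨fun hfree => ?_, fun ε hε => ?_⟩
  · obtain ⟨φ, hφ⟩ := OrdinalSystems.exists_isSplitting_of_isFree (Ordinal.omega_pos _) hfree
    exact OrdinalSystems.not_isSplitting n _ _ (OrdinalSystems.isCofinalFor_Iio_omega n)
      subset_rfl φ hφ
  · by_contra hlt
    refine hε ?_
    -- `Set.Iio ε` lives one universe above `ε.card`, so the bound has to be lifted.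
    have hcard : Cardinal.mk (Set.Iio ε) < Cardinal.aleph (n : Ordinal.{u + 1}) := by
      rw [Cardinal.mk_Iio_ordinal]
      have h1 : ε.card < Cardinal.aleph (n : Ordinal.{u}) := by
        rw [← Cardinal.lt_ord, Cardinal.ord_aleph]
        exact not_le.1 hlt
      have h2 := Cardinal.lift_lt.{u, u + 1}.2 h1
      rwa [Cardinal.lift_aleph, Ordinal.lift_natCast] at h2
    obtain ⟨J, lvl, x, hx⟩ := OrdinalSystems.exists_isFilteredBasis n (Set.Iio ε) hcard
    exact hx.isFree
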